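/- A semi-Heyting algebra is an algebra $\langle L,\vee,\wedge,\to,0,1\rangle$ such that $\langle L,\vee,\wedge,0,1\rangle$ is a bounded lattice and the identities $x\wedge(x\to y)\approx x\wedge y$, $x\wedge(y\to z)\approx x\wedge[(x\wedge y)\to(x\wedge z)]$ and $x\to x\approx 1$ hold; put $x^*:=x\to 0$. A dually quasi-De Morgan semi-Heyting algebra (DQD-algebra) is an algebra $\langle L,\vee,\wedge,\to,{}',0,1\rangle$ whose reduct $\langle L,\vee,\wedge,\to,0,1\rangle$ is a semi-Heyting algebra and which satisfies $0'\approx 1$, $1'\approx 0$, $(x\wedge y)'\approx x'\vee y'$, $(x\vee y)''\approx x''\vee y''$ and $x''\le x$. A variety of DQD-algebras is a class of DQD-algebras closed under homomorphic images, subalgebras (up to isomorphism) and arbitrary direct products; $\mathbf V(\mathbf K)$ is the least variety containing $\mathbf K$, and the join $\mathbf V\vee\mathbf W$ of two varieties is the least variety containing both. Let $\mathbf{JIDL_1}$ be the class of all DQD-algebras that satisfy 1. (JI-distributivity) $x'\vee(y\to z)\approx(x'\vee y)\to(x'\vee z)$, 2. (linearity) $(x\to y)\vee(y\to x)\approx 1$,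 3. (level $1$) $t_1(x)\approx t_2(x)$, where $t_1(x)=x\wedge x'^*$ and $t_2(x)=t_1(x)\wedge x'^{*}{}'^{*}$. Let $\mathbf{DStHC}$ be the variety generated by the dually Stone Heyting chains, that is, by the DQD-algebras that satisfy $x'\wedge x''\approx 0$ and $(x\wedge y)\to y\approx 1$ and whose lattice reduct is a chain. Let $\mathbf{D_2}$ be the DQD-algebra whose $\langle\vee,\wedge,\to,0,1\rangle$-reduct is the four-element Boolean algebra $\{0,a,b,1\}$ (with $x\to y$ the Boolean implication $x^*\vee y$), and where $0'=1$, $1'=0$, $a'=a$, $b'=b$. Then $$\mathbf{JIDL_1}=\mathbf{DStHC}\vee\mathbf V(\mathbf{D_2}).$$ In other words, the identities 1–3 axiomatize the join $\mathbf{DStHC}\vee\mathbf V(\mathbf{D_2})$ relative to the variety of all DQD-algebras. -/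

import Mathlib

/-- A semi-Heyting algebra `⟨L, ∨, ∧, →, 0, 1⟩`: a bounded lattice with an implication
satisfying (SH1), (SH2), (SH3). The operations are written `⊔, ⊓, ⇨, ⊥, ⊤`;
`HImp` only supplies the symbol `⇨`, without any law. -/
class SemiHeytingAlgebra (L : Type*) extends Lattice L, BoundedOrder L, HImp L where
  sh1 : ∀ x y : L, x ⊓ (x ⇨ y) = x ⊓ y
  sh2 : ∀ x y z : L, x ⊓ (y ⇨ z) = x ⊓ ((x ⊓ y) ⇨ (x ⊓ z))
  sh3 : ∀ x : L, x ⇨ x = ⊤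

/-- A dually quasi-De Morgan semi-Heyting algebra (`DQD`-algebra)
`⟨L, ∨, ∧, →, ', 0, 1⟩`. -/
class DQDAlgebra (L : Type*) extends SemiHeytingAlgebra L where
  /-- the dual quasi-De Morgan operation -/
  prime : L → L
  prime_bot : prime ⊥ = ⊤
  prime_top : prime ⊤ = ⊥
  prime_inf : ∀ x y : L, prime (x ⊓ y) = prime x ⊔ prime y
  prime_prime_sup : ∀ x y : L,
    prime (prime (x ⊔ y)) = prime (prime x) ⊔ prime (prime y)
  prime_prime_le : ∀ x : L, prime (prime x) ≤ x

namespace DQDAlgebra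

/-- `xᵈ` is the operation written `x'` in the comments. -/
postfix:max "ᵈ" => DQDAlgebra.prime

/-- The pseudocomplement `x* := x → 0`. -/
def pcompl {L : Type*} [DQDAlgebra L] (x : L) : L := x ⇨ ⊥

/-- The `n`-fold iterate of `x ↦ x'*`. -/
def primeStarIter {L : Type*} [DQDAlgebra L] : ℕ → L → L
  | 0, x => x
  | n + 1, x => pcompl (primeStarIter n x)ᵈ

/-- `t₀(x) = x` and `tₙ₊₁(x) = tₙ(x) ∧ x^((n+1)('*))`. -/
def levelTerm {L : Type*} [DQDAlgebra L] : ℕ → L → L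
  | 0, x => x
  | n + 1, x => levelTerm n x ⊓ primeStarIter (n + 1) x

/-- Homomorphisms of `DQD`-algebras: maps preserving all six operations. -/
structure IsHom {A B : Type*} [DQDAlgebra A] [DQDAlgebra B] (f : A → B) : Prop where
  map_sup : ∀ x y, f (x ⊔ y) = f x ⊔ f y
  map_inf : ∀ x y, f (x ⊓ y) = f x ⊓ f y
  map_himp : ∀ x y, f (x ⇨ y) = f x ⇨ f y
  map_prime : ∀ x, f xᵈ = (f x)ᵈ
  map_bot : f ⊥ = ⊥
  map_top : f ⊤ = ⊤

/-- Direct products, with all operations defined coordinatewise. -/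
instance piInstance {ι : Type*} {A : ι → Type*} [∀ i, DQDAlgebra (A i)] :
    DQDAlgebra (∀ i, A i) where
  sh1 _ _ := funext fun _ => SemiHeytingAlgebra.sh1 _ _
  sh2 _ _ _ := funext fun _ => SemiHeytingAlgebra.sh2 _ _ _
  sh3 _ := funext fun _ => SemiHeytingAlgebra.sh3 _
  prime x := fun i => (x i)ᵈ
  prime_bot := funext fun _ => prime_bot
  prime_top := funext fun _ => prime_top
  prime_inf _ _ := funext fun _ => prime_inf _ _
  prime_prime_sup _ _ := funext fun _ => prime_prime_sup _ _
  prime_prime_le _ := fun _ => prime_prime_le _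

end DQDAlgebra

/-- A bundled `DQD`-algebra; a class of `DQD`-algebras is a `Set DQD`. -/
structure DQD.{u} : Type (u + 1) where
  carrier : Type u
  [str : DQDAlgebra carrier]

namespace DQD

instance : CoeSort DQD (Type _) := ⟨DQD.carrier⟩

instance (A : DQD) : DQDAlgebra A := A.str

/-- A variety of `DQD`-algebras: a class of `DQD`-algebras closed under homomorphic images,
(isomorphic copies of) subalgebras, and direct products of arbitrary, possibly empty, families.
(`DQD`-algebras are themselves defined by identities, so such classes are exactly the varieties,
in the type `⟨∨, ∧, →, ', 0, 1⟩`, that consist of `DQD`-algebras.) -/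
structure IsVariety.{u} (V : Set DQD.{u}) : Prop where
  image : ∀ (A B : DQD.{u}) (f : A → B), DQDAlgebra.IsHom f → Function.Surjective f →
    A ∈ V → B ∈ V
  sub : ∀ (A B : DQD.{u}) (f : A → B), DQDAlgebra.IsHom f → Function.Injective f →
    B ∈ V → A ∈ V
  prod : ∀ (ι : Type u) (A : ι → DQD.{u}), (∀ i, A i ∈ V) → (⟨∀ i, A i⟩ : DQD.{u}) ∈ V

/-- `V(K)`, the variety generated by `K`: the intersection of all varieties containing `K`. -/
def generatedVariety.{u} (K : Set DQD.{u}) : Set DQD.{u} :=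
  ⋂₀ {V | IsVariety V ∧ K ⊆ V}

/-- The join of two varieties: the least variety containing both. -/
def varietyJoin.{u} (V W : Set DQD.{u}) : Set DQD.{u} :=
  generatedVariety (V ∪ W)

open DQDAlgebra

/-- JI-distributive algebras: `x' ∨ (y → z) ≈ (x' ∨ y) → (x' ∨ z)`. -/
def JID.{u} : Set DQD.{u} :=
  {A | ∀ x y z : A, xᵈ ⊔ (y ⇨ z) = (xᵈ ⊔ y) ⇨ (xᵈ ⊔ z)}

/-- `DQD`-algebras of level `n`: `tₙ(x) ≈ tₙ₊₁(x)`. -/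
def level.{u} (n : ℕ) : Set DQD.{u} :=
  {A | ∀ x : A, levelTerm n x = levelTerm (n + 1) x}

/-- Linear algebras: `(x → y) ∨ (y → x) ≈ 1`. -/
def linear.{u} : Set DQD.{u} :=
  {A | ∀ x y : A, (x ⇨ y) ⊔ (y ⇨ x) = ⊤}

/-- JI-distributive, dually quasi-De Morgan, linear semi-Heyting algebras. -/
def JIDL.{u} : Set DQD.{u} := JID ∩ linear

/-- `JIDL₁`: the members of `JIDL` of level `1`. -/
def JIDL₁.{u} : Set DQD.{u} := JIDL ∩ level 1

/-- `DStH`: dually Stone Heyting algebras, that is, `DQD`-algebras with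
`x' ∧ x'' ≈ 0` and `(x ∧ y) → y ≈ 1`. -/
def DStH.{u} : Set DQD.{u} :=
  {A | (∀ x : A, xᵈ ⊓ xᵈᵈ = ⊥) ∧ ∀ x y : A, (x ⊓ y) ⇨ y = ⊤}

/-- Algebras whose lattice reduct is a chain. -/
def chains.{u} : Set DQD.{u} :=
  {A | ∀ x y : A, x ≤ y ∨ y ≤ x}

/-- `DStHC`: the variety generated by the dually Stone Heyting chains. -/
def DStHC.{u} : Set DQD.{u} := generatedVariety (DStH ∩ chains)

end DQD

/-- The universe `{0, a, b, 1}` of the algebra `D₂`. -/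
inductive D₂.{u} : Type u
  | zero | a | b | one

namespace D₂

/-- The join of the four-element Boolean lattice in which `a` and `b` are complements. -/
def sup : D₂ → D₂ → D₂
  | zero, y => y
  | x, zero => x
  | a, a => a
  | b, b => b
  | _, _ => one

/-- The meet of the four-element Boolean lattice in which `a` and `b` are complements. -/
def inf : D₂ → D₂ → D₂
  | one, y => y
  | x, one => x
  | a, a => a
  | b, b => b
  | _, _ => zero

/-- The table of the implication of `D₂`. -/
def imp : D₂ → D₂ → D₂
  | zero, _ => one
  | one, y => y
  | a, zero => b
  | a, one => one
  | a, a => one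
  | a, b => b
  | b, zero => a
  | b, one => one
  | b, a => a
  | b, b => one

/-- The operation `'` of `D₂`: `0' = 1`, `1' = 0`, `a' = a`, `b' = b`. -/
def neg : D₂ → D₂
  | zero => one
  | one => zero
  | a => a
  | b => b

instance : DQDAlgebra D₂ where
  le x y := sup x y = y
  le_refl x := by cases x <;> rfl
  le_trans x y z := by cases x <;> cases y <;> cases z <;> simp [sup]
  le_antisymm x y := by cases x <;> cases y <;> simp [sup]
  sup := sup
  le_sup_left x y := by cases x <;> cases y <;> rfl
  le_sup_right x y := by cases x <;> cases y <;> rfl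
  sup_le x y z := by cases x <;> cases y <;> cases z <;> simp [sup]
  inf := inf
  inf_le_left x y := by cases x <;> cases y <;> rfl
  inf_le_right x y := by cases x <;> cases y <;> rfl
  le_inf x y z := by cases x <;> cases y <;> cases z <;> simp [sup, inf]
  top := one
  le_top x := by cases x <;> rfl
  bot := zero
  bot_le x := by cases x <;> rfl
  himp := imp
  sh1 x y := by cases x <;> cases y <;> rfl
  sh2 x y z := by cases x <;> cases y <;> cases z <;> rfl
  sh3 x := by cases x <;> rfl
  prime := neg
  prime_bot := rfl
  prime_top := rfl
  prime_inf x y := by cases x <;> cases y <;> rfl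
  prime_prime_sup x y := by cases x <;> cases y <;> rfl
  prime_prime_le x := by cases x <;> rfl

end D₂

/-! The inclusion into the join is a subdirect representation: it is enough to separate the points
of an algebra `L` in `JIDL₁` by homomorphisms into dually Stone Heyting chains or `D₂`. Linearity
makes `L` a Heyting algebra, JI-distributivity makes every `x'` complemented, and level 1 then says
`x ≤ x' ∨ x''`. Given `u ≰ v`, take a prime filter `P` containing `u` but not `v`, and set `Q = {x |
x' ∉ P}`, which is again a prime filter. If `P ⊆ Q` or `Q ⊆ P`, the smaller filter is closed under
`x ↦ x'*`, so it defines a congruence; by linearity and primeness the quotient is a chain, and it is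
dually Stone. If `P` and `Q` are incomparable, both are maximal and `'` interchanges them, so
recording membership in `P` and in `Q` maps `L` to `D₂`. Conversely, the identities hold in the
generators and define a variety. -/

open DQDAlgebra

/-- The defining identities of `JIDL₁`, as a property of a `DQD`-algebra. -/
class IsJIDL₁ (L : Type*) [DQDAlgebra L] : Prop where
  jid : ∀ x y z : L, xᵈ ⊔ (y ⇨ z) = (xᵈ ⊔ y) ⇨ (xᵈ ⊔ z)
  linear : ∀ x y : L, (x ⇨ y) ⊔ (y ⇨ x) = ⊤
  level : ∀ x : L, levelTerm 1 x = levelTerm 2 x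

/-! ### Linear semi-Heyting algebras are Heyting -/

/-- In a linear semi-Heyting algebra, `x ≤ y` implies `x → y = 1`. -/
theorem SemiHeytingAlgebra.himp_eq_top_of_le {L : Type*} [SemiHeytingAlgebra L]
    (lin : ∀ x y : L, (x ⇨ y) ⊔ (y ⇨ x) = ⊤) {x y : L} (h : x ≤ y) : x ⇨ y = ⊤ := by
  have h1 : x ⊓ (y ⇨ x) = x := by
    rw [sh2, inf_eq_left.2 h, inf_idem, sh3, inf_top_eq]
  have h2 : (y ⇨ x) ⊓ y = x := by rw [inf_comm, sh1, inf_eq_right.2 h]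
  -- Below `y → x` the elements `x` and `y` coincide, so there `x → y` acts as `x → x`. The
  -- linearity join thus collapses to `x → y`.
  have h3 : (y ⇨ x) ≤ x ⇨ y := by
    rw [← inf_eq_left, sh2 (y ⇨ x) x y, h2, inf_comm _ x, h1, sh3, inf_top_eq]
  rw [← lin x y, sup_eq_left.2 h3]

/-- A linear semi-Heyting algebra is residuated. -/
theorem SemiHeytingAlgebra.le_himp_iff_of_linear {L : Type*} [SemiHeytingAlgebra L]
    (lin : ∀ x y : L, (x ⇨ y) ⊔ (y ⇨ x) = ⊤) (x y z : L) : x ≤ y ⇨ z ↔ x ⊓ y ≤ z := by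
  constructor
  · intro h
    calc x ⊓ y ≤ y ⊓ (y ⇨ z) := le_inf inf_le_right (inf_le_left.trans h)
      _ = y ⊓ z := sh1 _ _
      _ ≤ z := inf_le_right
  · intro h
    rw [← inf_eq_left, sh2, himp_eq_top_of_le lin (le_inf inf_le_left h), inf_top_eq]

/-! ### Arithmetic of `'` in `JIDL₁` -/

namespace IsJIDL₁

variable {L : Type*} [DQDAlgebra L] [IsJIDL₁ L]

instance : HeytingAlgebra L where
  le_himp_iff := SemiHeytingAlgebra.le_himp_iff_of_linear linear
  compl := pcompl
  himp_bot _ := rfl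

theorem prime_anti {L : Type*} [DQDAlgebra L] {x y : L} (h : x ≤ y) : yᵈ ≤ xᵈ := by
  rw [← inf_eq_left.2 h, prime_inf]
  exact le_sup_right

theorem prime_prime_prime {L : Type*} [DQDAlgebra L] (x : L) : xᵈᵈᵈ = xᵈ :=
  le_antisymm (prime_prime_le _) (prime_anti (prime_prime_le _))

/-- JI-distributivity at `y = x'`, `z = 0` reads `x' ∨ x'* = x' → x' = 1`. -/
theorem isCompl_prime (x : L) : IsCompl xᵈ (xᵈ)ᶜ := by
  refine IsCompl.of_eq (inf_compl_self _) ?_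
  have h := jid x xᵈ ⊥
  rwa [sup_idem, sup_bot_eq, himp_self, himp_bot] at h

theorem prime_prime_of_isCompl {k l : L} (h : IsCompl k l) : kᵈᵈ = k := by
  refine le_antisymm (prime_prime_le k) ?_
  have h1 : kᵈᵈ ⊔ lᵈᵈ = ⊤ := by
    rw [← prime_prime_sup, h.sup_eq_top, prime_top, prime_bot]
  calc k = k ⊓ (kᵈᵈ ⊔ lᵈᵈ) := by rw [h1, inf_top_eq]
    _ = k ⊓ kᵈᵈ ⊔ k ⊓ lᵈᵈ := inf_sup_left _ _ _
    _ ≤ kᵈᵈ ⊔ k ⊓ l := sup_le_sup inf_le_right (inf_le_inf_left _ (prime_prime_le l))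
    _ = kᵈᵈ := by rw [h.inf_eq_bot, sup_bot_eq]

/-- The left side equals `(x' ∧ y')''`, and `''` fixes complemented elements such as `x' ∧ y'`. -/
theorem prime_sup (x y : L) : (x ⊔ y)ᵈ = xᵈ ⊓ yᵈ := by
  rw [← prime_prime_prime, prime_prime_sup, ← prime_inf]
  exact prime_prime_of_isCompl ((isCompl_prime x).inf_sup (isCompl_prime y))

theorem isCompl_prime_prime (x : L) : IsCompl xᵈᵈ (xᵈ)ᶜᵈ := by
  refine IsCompl.of_eq ?_ ?_
  · rw [← prime_sup, (isCompl_prime x).sup_eq_top, prime_top]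
  · rw [← prime_inf, (isCompl_prime x).inf_eq_bot, prime_bot]

/-- The form in which level `1` is used: `x ≤ x' ∨ x''`. -/
theorem le_prime_sup_prime_prime (x : L) : x ≤ xᵈ ⊔ xᵈᵈ := by
  have h : x ⊓ (xᵈ)ᶜ = (x ⊓ (xᵈ)ᶜ) ⊓ ((xᵈ)ᶜᵈ)ᶜ := level x
  -- The last factor `x'*'*` of `t₂(x)` is `x''`, so level 1 gives `x ∧ x'* ≤ x''`.
  rw [(isCompl_prime_prime x).symm.compl_eq] at h
  calc x = x ⊓ (xᵈ ⊔ (xᵈ)ᶜ) := by rw [(isCompl_prime x).sup_eq_top, inf_top_eq]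
    _ = x ⊓ xᵈ ⊔ x ⊓ (xᵈ)ᶜ := inf_sup_left _ _ _
    _ ≤ xᵈ ⊔ xᵈᵈ := sup_le_sup inf_le_right (by rw [h]; exact inf_le_right)

end IsJIDL₁

/-! ### Prime filters and the partner filter `{x | x' ∉ P}` -/

/-- Prime filters of a bounded lattice. -/
structure IsPrimeFilter {L : Type*} [Lattice L] [BoundedOrder L] (P : Set L) : Prop where
  top_mem : ⊤ ∈ P
  bot_notMem : ⊥ ∉ P
  inf_mem_iff : ∀ {x y}, x ⊓ y ∈ P ↔ x ∈ P ∧ y ∈ P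
  sup_mem_iff : ∀ {x y}, x ⊔ y ∈ P ↔ x ∈ P ∨ y ∈ P

namespace IsPrimeFilter

theorem mem_of_le {L : Type*} [Lattice L] [BoundedOrder L] {P : Set L} (hP : IsPrimeFilter P)
    {x y : L} (hx : x ∈ P) (h : x ≤ y) : y ∈ P := by
  rw [← inf_eq_left.2 h] at hx
  exact (hP.inf_mem_iff.1 hx).2

theorem mem_iff_of_isCompl {L : Type*} [Lattice L] [BoundedOrder L] {P : Set L}
    (hP : IsPrimeFilter P) {x y : L} (h : IsCompl x y) : y ∈ P ↔ x ∉ P := by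
  constructor
  · intro hy hx
    exact hP.bot_notMem (h.inf_eq_bot ▸ hP.inf_mem_iff.2 ⟨hx, hy⟩)
  · intro hx
    have := hP.top_mem
    rw [← h.sup_eq_top, hP.sup_mem_iff] at this
    exact this.resolve_left hx

theorem exists_of_not_le {L : Type*} [DistribLattice L] [BoundedOrder L] {u v : L}
    (h : ¬ u ≤ v) : ∃ P : Set L, IsPrimeFilter P ∧ u ∈ P ∧ v ∉ P := by
  have hd : Disjoint (Order.PFilter.principal u : Set L) (Order.Ideal.principal v : Set L) := by
    rw [Set.disjoint_left]
    intro x hx hx'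
    exact h (le_trans (Order.PFilter.mem_principal.1 hx) (Order.Ideal.mem_principal.1 hx'))
  obtain ⟨J, hJ, hvJ, huJ⟩ := DistribLattice.prime_ideal_of_disjoint_filter_ideal hd
  refine ⟨(J : Set L)ᶜ, ⟨?_, ?_, ?_, ?_⟩, ?_, ?_⟩
  · exact hJ.toIsProper.top_notMem
  · exact fun hb => hb J.bot_mem
  · intro x y
    constructor
    · exact fun hxy => ⟨fun hx => hxy (J.lower inf_le_left hx),
        fun hy => hxy (J.lower inf_le_right hy)⟩
    · rintro ⟨hx, hy⟩ hxy
      exact (hJ.mem_or_mem hxy).elim hx hy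
  · intro x y
    simp only [Set.mem_compl_iff, SetLike.mem_coe, Order.Ideal.sup_mem_iff]
    tauto
  · exact Set.disjoint_left.1 huJ (Order.PFilter.mem_principal.2 le_rfl)
  · exact fun hv => hv (hvJ (Order.Ideal.mem_principal.2 le_rfl))

variable {L : Type*} [DQDAlgebra L] [IsJIDL₁ L] {P : Set L}

open IsJIDL₁

/-- The prime filter `{x | x' ∉ P}`. -/
theorem setOf_prime_notMem (hP : IsPrimeFilter P) : IsPrimeFilter {x : L | xᵈ ∉ P} where
  top_mem := by
    rw [Set.mem_ofPred_eq, prime_top]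
    exact hP.bot_notMem
  bot_notMem := by
    rw [Set.mem_ofPred_eq, prime_bot, not_not]
    exact hP.top_mem
  inf_mem_iff {x y} := by
    simp only [Set.mem_ofPred_eq, prime_inf, hP.sup_mem_iff, not_or]
  sup_mem_iff {x y} := by
    simp only [Set.mem_ofPred_eq, prime_sup, hP.inf_mem_iff, not_and_or]

/-- The filter `P ∩ {x | x' ∉ P}` is closed under `x ↦ x'*`. -/
theorem compl_prime_mem (hP : IsPrimeFilter P) {x : L} (hx : x ∈ P) (hx' : xᵈ ∉ P) :
    (xᵈ)ᶜ ∈ P ∧ (xᵈ)ᶜᵈ ∉ P := by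
  refine ⟨(hP.mem_iff_of_isCompl (isCompl_prime x)).2 hx', ?_⟩
  rw [hP.mem_iff_of_isCompl (isCompl_prime_prime x), not_not]
  exact (hP.sup_mem_iff.1 (hP.mem_of_le hx (le_prime_sup_prime_prime x))).resolve_left hx'

theorem compl_mem_of_prime_notMem (hP : IsPrimeFilter P) {x r : L} (hxr : x ≤ r)
    (h1 : rᵈ ∉ P) (h2 : rᵈᵈ ∉ P) : xᶜ ∈ P := by
  have h : (rᵈ)ᶜ ⊓ (rᵈᵈ)ᶜ ∈ P := hP.inf_mem_iff.2
    ⟨(hP.mem_iff_of_isCompl (isCompl_prime r)).2 h1,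
      (hP.mem_iff_of_isCompl (isCompl_prime rᵈ)).2 h2⟩
  refine hP.mem_of_le h ?_
  rw [← compl_sup]
  exact compl_le_compl (hxr.trans (le_prime_sup_prime_prime r))

theorem himp_mem_iff (hP : IsPrimeFilter P) (hmax : ∀ x, x ∉ P → xᶜ ∈ P) (x y : L) :
    (x ⇨ y) ∈ P ↔ (x ∈ P → y ∈ P) := by
  constructor
  · intro h hx
    exact hP.mem_of_le (hP.inf_mem_iff.2 ⟨hx, h⟩) inf_himp_le
  · intro h
    by_cases hx : x ∈ P
    · exact hP.mem_of_le (h hx) le_himp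
    · exact hP.mem_of_le (hmax x hx) (himp_le_himp_left bot_le)

/-- Says that passing twice from `P` to `{x | x' ∉ P}` returns `P`, given some `q` in the partner
filter but outside `P`. Level 1 at `x ∨ q` leaves only the term `x''` that can lie in `P`. -/
theorem prime_prime_mem_iff (hP : IsPrimeFilter P) {q : L} (hq : q ∉ P) (hq' : qᵈ ∉ P)
    (x : L) : xᵈᵈ ∈ P ↔ x ∈ P := by
  refine ⟨fun h => hP.mem_of_le h (prime_prime_le x), fun hx => ?_⟩
  have h := hP.mem_of_le (hP.sup_mem_iff.2 (Or.inl hx)) (le_prime_sup_prime_prime (x ⊔ q))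
  rw [prime_prime_sup, prime_sup] at h
  simp only [hP.sup_mem_iff, hP.inf_mem_iff, hq', and_false, false_or] at h
  exact h.resolve_right fun h' => hq (hP.mem_of_le h' (prime_prime_le q))

end IsPrimeFilter

/-! ### Quotient by a filter closed under `x ↦ x'*` -/

section FilterQuotient

variable {L : Type*} [DQDAlgebra L] [IsJIDL₁ L] {F : Set L}

open IsJIDL₁

/-- The congruence of a normal prime filter: `x ~ y` when `x ∧ f = y ∧ f` for some `f ∈ F`. -/
def IsPrimeFilter.setoid (hF : IsPrimeFilter F) : Setoid L where
  r x y := ∃ f ∈ F, x ⊓ f = y ⊓ f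
  iseqv :=
    { refl := fun _ => ⟨⊤, hF.top_mem, rfl⟩
      symm := fun ⟨f, hf, h⟩ => ⟨f, hf, h.symm⟩
      trans := by
        rintro x y z ⟨f, hf, h⟩ ⟨g, hg, h'⟩
        refine ⟨f ⊓ g, hF.inf_mem_iff.2 ⟨hf, hg⟩, ?_⟩
        rw [← inf_assoc, h, inf_right_comm, h', inf_right_comm, inf_assoc] }

theorem inf_eq_inf_of_le {L : Type*} [SemilatticeInf L] {x y f g : L} (h : x ⊓ f = y ⊓ f)
    (hg : g ≤ f) : x ⊓ g = y ⊓ g := by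
  rw [← inf_eq_right.2 hg, ← inf_assoc, h, inf_assoc]

theorem IsPrimeFilter.setoid_map₂ {L : Type*} [DQDAlgebra L] {F : Set L} (hF : IsPrimeFilter F) {op : L → L → L}
    (hop : ∀ f x y x₁ y₁, x ⊓ f = x₁ ⊓ f → y ⊓ f = y₁ ⊓ f → op x y ⊓ f = op x₁ y₁ ⊓ f)
    ⦃x x₁ : L⦄ (hx : hF.setoid x x₁) ⦃y y₁ : L⦄ (hy : hF.setoid y y₁) :
    hF.setoid (op x y) (op x₁ y₁) := by
  obtain ⟨f, hf, hx⟩ := hx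
  obtain ⟨g, hg, hy⟩ := hy
  exact ⟨f ⊓ g, hF.inf_mem_iff.2 ⟨hf, hg⟩,
    hop _ _ _ _ _ (inf_eq_inf_of_le hx inf_le_left) (inf_eq_inf_of_le hy inf_le_right)⟩

/-- The quotient of an algebra by a prime filter closed under `x ↦ x'*`. -/
@[reducible] def IsPrimeFilter.quotient (hF : IsPrimeFilter F)
    (hn : ∀ x ∈ F, (xᵈ)ᶜ ∈ F) : DQDAlgebra (Quotient hF.setoid) :=
  let sup : Quotient hF.setoid → Quotient hF.setoid → Quotient hF.setoid :=
    Quotient.map₂ (· ⊔ ·) (hF.setoid_map₂ fun f x y x₁ y₁ hx hy => by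
      rw [inf_sup_right, hx, hy, inf_sup_right])
  let inf : Quotient hF.setoid → Quotient hF.setoid → Quotient hF.setoid :=
    Quotient.map₂ (· ⊓ ·) (hF.setoid_map₂ fun f x y x₁ y₁ hx hy => by
      rw [inf_inf_distrib_right, hx, hy, ← inf_inf_distrib_right])
  let himp : Quotient hF.setoid → Quotient hF.setoid → Quotient hF.setoid :=
    Quotient.map₂ (· ⇨ ·) (hF.setoid_map₂ fun f x y x₁ y₁ hx hy => by
      -- By (SH2), `(x → y) ∧ f` depends only on `x ∧ f` and `y ∧ f`.
      rw [inf_comm, SemiHeytingAlgebra.sh2, inf_comm f x, inf_comm f y, hx, hy,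
        inf_comm _ f, inf_comm _ f, ← SemiHeytingAlgebra.sh2, inf_comm])
  let prime : Quotient hF.setoid → Quotient hF.setoid :=
    Quotient.map prime (by
      rintro x y ⟨f, hf, h⟩
      -- Priming the hypothesis gives `x' ∨ f' = y' ∨ f'`; meeting with `f'*` removes `f'`.
      refine ⟨(fᵈ)ᶜ, hn f hf, ?_⟩
      have h' := congrArg (fun z => zᵈ ⊓ (fᵈ)ᶜ) h
      simpa only [prime_inf, inf_sup_right, inf_compl_self, sup_bot_eq] using h')
  { toLattice := @Lattice.mk' _ ⟨sup⟩ ⟨inf⟩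
      (by rintro ⟨x⟩ ⟨y⟩; exact congrArg (Quotient.mk _) (sup_comm x y))
      (by rintro ⟨x⟩ ⟨y⟩ ⟨z⟩; exact congrArg (Quotient.mk _) (sup_assoc x y z))
      (by rintro ⟨x⟩ ⟨y⟩; exact congrArg (Quotient.mk _) (inf_comm x y))
      (by rintro ⟨x⟩ ⟨y⟩ ⟨z⟩; exact congrArg (Quotient.mk _) (inf_assoc x y z))
      (by rintro ⟨x⟩ ⟨y⟩; exact congrArg (Quotient.mk _) (sup_inf_self (a := x) (b := y)))
      (by rintro ⟨x⟩ ⟨y⟩; exact congrArg (Quotient.mk _) (inf_sup_self (a := x) (b := y)))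
    top := Quotient.mk _ ⊤
    bot := Quotient.mk _ ⊥
    le_top := by rintro ⟨x⟩; exact congrArg (Quotient.mk _) (sup_top_eq x)
    bot_le := by rintro ⟨x⟩; exact congrArg (Quotient.mk _) (bot_sup_eq x)
    himp := himp
    sh1 := by
      rintro ⟨x⟩ ⟨y⟩; exact congrArg (Quotient.mk _) (SemiHeytingAlgebra.sh1 x y)
    sh2 := by
      rintro ⟨x⟩ ⟨y⟩ ⟨z⟩; exact congrArg (Quotient.mk _) (SemiHeytingAlgebra.sh2 x y z)
    sh3 := by rintro ⟨x⟩; exact congrArg (Quotient.mk _) (SemiHeytingAlgebra.sh3 x)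
    prime := prime
    prime_bot := congrArg (Quotient.mk _) (prime_bot (L := L))
    prime_top := congrArg (Quotient.mk _) (prime_top (L := L))
    prime_inf := by rintro ⟨x⟩ ⟨y⟩; exact congrArg (Quotient.mk _) (prime_inf x y)
    prime_prime_sup := by
      rintro ⟨x⟩ ⟨y⟩; exact congrArg (Quotient.mk _) (prime_prime_sup x y)
    prime_prime_le := by
      rintro ⟨x⟩; exact congrArg (Quotient.mk _) (sup_eq_right.2 (prime_prime_le x)) }

end FilterQuotient

/-! ### Separating homomorphisms -/

namespace DQD

open IsJIDL₁

/-- A prime filter closed under `x ↦ x'*` separates points outside it by a homomorphism to a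
dually Stone Heyting chain. -/
theorem exists_hom_chain.{u} {L : Type u} [DQDAlgebra L] [IsJIDL₁ L] {F : Set L}
    (hF : IsPrimeFilter F) (hn : ∀ x ∈ F, (xᵈ)ᶜ ∈ F) {u v : L} (huv : (u ⇨ v) ∉ F) :
    ∃ B ∈ DStH.{u} ∩ chains, ∃ f : L → B, IsHom f ∧ f u ≠ f v := by
  let := hF.quotient hn
  refine ⟨⟨Quotient hF.setoid⟩, ⟨⟨?_, ?_⟩, ?_⟩, Quotient.mk hF.setoid, ?_, fun h => huv ?_⟩
  · rintro ⟨x⟩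
    refine Quotient.sound (s := hF.setoid) (a := xᵈ ⊓ xᵈᵈ) (b := ⊥) ?_
    have h : xᵈ ⊔ (xᵈ)ᶜ ∈ F := (isCompl_prime x).sup_eq_top ▸ hF.top_mem
    -- If `x' ∈ F`, then `x''* ∈ F` annihilates `x''`; otherwise `x'* ∈ F` annihilates `x'`.
    rcases hF.sup_mem_iff.1 h with h | h
    · exact ⟨_, hn _ h, by rw [bot_inf_eq, inf_assoc, inf_compl_self, inf_bot_eq]⟩
    · exact ⟨_, h, by rw [bot_inf_eq, inf_right_comm, inf_compl_self, bot_inf_eq]⟩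
  · rintro ⟨x⟩ ⟨y⟩
    exact congrArg (Quotient.mk hF.setoid) (himp_eq_top_iff.2 (inf_le_right (a := x) (b := y)))
  · rintro ⟨x⟩ ⟨y⟩
    -- The quotient order is defined by `x ∨ y = y`, hence this form of the congruence.
    have key : ∀ x y : L, (x ⇨ y) ∈ F → hF.setoid (x ⊔ y) y := by
      intro x y hxy
      refine ⟨_, hxy, ?_⟩
      rw [inf_sup_right, sup_eq_right, le_inf_iff]
      exact ⟨inf_himp_le, inf_le_right⟩
    have h : (x ⇨ y) ⊔ (y ⇨ x) ∈ F := IsJIDL₁.linear x y ▸ hF.top_mem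
    rcases hF.sup_mem_iff.1 h with h | h
    · exact Or.inl (Quotient.sound (key x y h))
    · exact Or.inr (Quotient.sound (key y x h))
  · exact ⟨fun _ _ => rfl, fun _ _ => rfl, fun _ _ => rfl, fun _ => rfl, rfl, rfl⟩
  · obtain ⟨f, hf, h⟩ := Quotient.exact h
    exact hF.mem_of_le hf (le_himp_iff.2 (by rw [inf_comm, h]; exact inf_le_left))

/-- The element of `D₂` with given values at its two prime filters. -/
def d₂OfProp (p q : Prop) [Decidable p] [Decidable q] : D₂ :=
  if p then if q then .one else .a else if q then .b else .zero

open Classical in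
theorem exists_hom_D₂ {L : Type*} [DQDAlgebra L] [IsJIDL₁ L] {P : Set L}
    (hP : IsPrimeFilter P) {p q : L} (hp : p ∈ P) (hp' : pᵈ ∈ P) (hq : q ∉ P) (hq' : qᵈ ∉ P) :
    ∃ f : L → D₂, IsHom f ∧ ∀ u v, u ∈ P → v ∉ P → f u ≠ f v := by
  have hQ := hP.setOf_prime_notMem
  have hpp := hP.prime_prime_mem_iff hq hq'
  -- The witness `x ∨ q` stays outside `P` while `q' ∉ P` keeps `(x ∨ q)'` outside too. For the
  -- partner filter, `p` plays the role of `q`.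
  have hPmax : ∀ x, x ∉ P → xᶜ ∈ P := by
    intro x hx
    refine hP.compl_mem_of_prime_notMem (le_sup_left (a := x) (b := q)) ?_ ?_
    · rw [prime_sup, hP.inf_mem_iff]; exact fun h => hq' h.2
    · rw [hpp, hP.sup_mem_iff]; exact fun h => h.elim hx hq
  have hQmax : ∀ x, x ∉ {x : L | xᵈ ∉ P} → xᶜ ∈ {x : L | xᵈ ∉ P} := by
    intro x hx
    refine hQ.compl_mem_of_prime_notMem (le_sup_left (a := x) (b := p)) ?_ ?_
    · rw [Set.mem_ofPred_eq, hpp, hP.sup_mem_iff, not_not]; exact Or.inr hp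
    · rw [Set.mem_ofPred_eq, prime_prime_prime, prime_sup, hP.inf_mem_iff, not_not]
      exact ⟨not_not.1 hx, hp'⟩
  have hI := hP.himp_mem_iff hPmax
  have hJ := hQ.himp_mem_iff hQmax
  simp only [Set.mem_ofPred_eq] at hJ
  refine ⟨fun x => d₂OfProp (x ∈ P) (xᵈ ∉ P), ⟨?_, ?_, ?_, ?_, ?_, ?_⟩, ?_⟩
  · intro x y
    simp only [prime_sup, hP.inf_mem_iff, hP.sup_mem_iff]
    by_cases x ∈ P <;> by_cases y ∈ P <;> by_cases xᵈ ∈ P <;> by_cases yᵈ ∈ P <;>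
      simp only [*, d₂OfProp] <;> simp <;> rfl
  · intro x y
    simp only [prime_inf, hP.inf_mem_iff, hP.sup_mem_iff]
    by_cases x ∈ P <;> by_cases y ∈ P <;> by_cases xᵈ ∈ P <;> by_cases yᵈ ∈ P <;>
      simp only [*, d₂OfProp] <;> simp <;> rfl
  · intro x y
    simp only [hI, hJ]
    by_cases x ∈ P <;> by_cases y ∈ P <;> by_cases xᵈ ∈ P <;> by_cases yᵈ ∈ P <;>
      simp only [*, d₂OfProp] <;> simp <;> rfl
  · intro x
    simp only [hpp]
    by_cases x ∈ P <;> by_cases xᵈ ∈ P <;>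
      simp only [*, d₂OfProp] <;> simp <;> rfl
  · simp only [prime_bot, hP.top_mem, hP.bot_notMem, d₂OfProp]
    simp
    rfl
  · simp only [prime_top, hP.top_mem, hP.bot_notMem, d₂OfProp]
    simp
    rfl
  · intro u v hu hv
    by_cases uᵈ ∈ P <;> by_cases vᵈ ∈ P <;> simp [*, d₂OfProp]

theorem exists_separating_hom.{u} {L : Type u} [DQDAlgebra L] [IsJIDL₁ L] {u v : L}
    (huv : ¬ u ≤ v) :
    ∃ B ∈ (DStH.{u} ∩ chains) ∪ {⟨D₂⟩}, ∃ f : L → B, IsHom f ∧ f u ≠ f v := by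
  obtain ⟨P, hP, hu, hv⟩ := IsPrimeFilter.exists_of_not_le huv
  -- Unlike the membership of `u` and `v`, the failure of `u → v` to belong passes to any smaller
  -- filter, as the case `Q ⊆ P` requires.
  have himp : (u ⇨ v) ∉ P := fun h => hv (hP.mem_of_le (hP.inf_mem_iff.2 ⟨hu, h⟩) inf_himp_le)
  by_cases hPQ : ∀ x ∈ P, xᵈ ∉ P
  · obtain ⟨B, hB, f, hf⟩ := exists_hom_chain hP
      (fun x hx => (hP.compl_prime_mem hx (hPQ x hx)).1) himp
    exact ⟨B, Or.inl hB, f, hf⟩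
  by_cases hQP : ∀ x, xᵈ ∉ P → x ∈ P
  · obtain ⟨B, hB, f, hf⟩ := exists_hom_chain hP.setOf_prime_notMem
      (fun x hx => (hP.compl_prime_mem (hQP x hx) hx).2) fun h => himp (hQP _ h)
    exact ⟨B, Or.inl hB, f, hf⟩
  push Not at hPQ hQP
  obtain ⟨p, hp, hp'⟩ := hPQ
  obtain ⟨q, hq', hq⟩ := hQP
  obtain ⟨f, hf, hs⟩ := exists_hom_D₂ hP hp hp' hq hq'
  exact ⟨⟨D₂⟩, Or.inr rfl, f, hf, hs u v hu hv⟩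

/-! ### Generated varieties and the converse inclusion -/

theorem subset_generatedVariety.{u} (K : Set DQD.{u}) : K ⊆ generatedVariety K :=
  Set.subset_sInter fun _ hV => hV.2

theorem generatedVariety_subset.{u} {K V : Set DQD.{u}} (hV : IsVariety V) (h : K ⊆ V) :
    generatedVariety K ⊆ V :=
  Set.sInter_subset_of_mem ⟨hV, h⟩

/-- An algebra whose points are separated by homomorphisms into members of a variety belongs to
that variety. -/
theorem IsVariety.mem_of_separating.{u} {V : Set DQD.{u}} (hV : IsVariety V) (A : DQD.{u})
    (h : ∀ u v : A, u ≠ v → ∃ B ∈ V, ∃ f : A → B, IsHom f ∧ f u ≠ f v) : A ∈ V := by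
  choose B hB f hf hne using fun i : {i : A × A // i.1 ≠ i.2} => h i.1.1 i.1.2 i.2
  refine hV.sub A ⟨∀ i, B i⟩ (fun x i => f i x) ⟨?_, ?_, ?_, ?_, ?_, ?_⟩ ?_ (hV.prod _ B hB)
  · exact fun x y => funext fun i => (hf i).map_sup x y
  · exact fun x y => funext fun i => (hf i).map_inf x y
  · exact fun x y => funext fun i => (hf i).map_himp x y
  · exact fun x => funext fun i => (hf i).map_prime x
  · exact funext fun i => (hf i).map_bot
  · exact funext fun i => (hf i).map_top
  · intro x y hxy
    by_contra hne'
    exact hne ⟨(x, y), hne'⟩ (congrFun hxy _)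

theorem mem_JIDL₁_iff.{u} {A : DQD.{u}} : A ∈ JIDL₁ ↔ IsJIDL₁ A :=
  ⟨fun h => ⟨h.1.1, h.1.2, h.2⟩, fun h => ⟨⟨h.jid, h.linear⟩, h.level⟩⟩

theorem map_levelTerm_one {A B : Type*} [DQDAlgebra A] [DQDAlgebra B] {f : A → B}
    (hf : IsHom f) (x : A) : f (levelTerm 1 x) = levelTerm 1 (f x) := by
  simp only [levelTerm, primeStarIter, pcompl, hf.map_inf, hf.map_himp, hf.map_prime, hf.map_bot]

theorem map_levelTerm_two {A B : Type*} [DQDAlgebra A] [DQDAlgebra B] {f : A → B}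
    (hf : IsHom f) (x : A) : f (levelTerm 2 x) = levelTerm 2 (f x) := by
  simp only [levelTerm, primeStarIter, pcompl, hf.map_inf, hf.map_himp, hf.map_prime, hf.map_bot]

theorem isVariety_JIDL₁.{u} : IsVariety JIDL₁.{u} where
  image A B f hf hs hA := by
    rw [mem_JIDL₁_iff] at hA ⊢
    refine ⟨?_, ?_, ?_⟩
    · intro x y z
      obtain ⟨x, rfl⟩ := hs x
      obtain ⟨y, rfl⟩ := hs y
      obtain ⟨z, rfl⟩ := hs z
      simp only [← hf.map_sup, ← hf.map_himp, ← hf.map_prime, hA.jid]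
    · intro x y
      obtain ⟨x, rfl⟩ := hs x
      obtain ⟨y, rfl⟩ := hs y
      simp only [← hf.map_sup, ← hf.map_himp, ← hf.map_top, hA.linear]
    · intro x
      obtain ⟨x, rfl⟩ := hs x
      rw [← map_levelTerm_one hf, ← map_levelTerm_two hf, hA.level]
  sub A B f hf hi hB := by
    rw [mem_JIDL₁_iff] at hB ⊢
    refine ⟨?_, ?_, ?_⟩
    · intro x y z
      apply hi
      simp only [hf.map_sup, hf.map_himp, hf.map_prime, hB.jid]
    · intro x y
      apply hi
      simp only [hf.map_sup, hf.map_himp, hf.map_top, hB.linear]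
    · intro x
      apply hi
      rw [map_levelTerm_one hf, map_levelTerm_two hf, hB.level]
  prod ι A h := by
    simp only [mem_JIDL₁_iff] at h ⊢
    exact ⟨fun x y z => funext fun i => (h i).jid (x i) (y i) (z i),
      fun x y => funext fun i => (h i).linear (x i) (y i),
      fun x => funext fun i => (h i).level (x i)⟩

theorem chain_subset_JIDL₁.{u} : DStH ∩ chains ⊆ JIDL₁.{u} := by
  rintro A ⟨⟨hst, hh⟩, hc⟩
  have hle : ∀ x y : A, x ≤ y → x ⇨ y = ⊤ := by
    intro x y hxy
    rw [← inf_eq_left.2 hxy]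
    exact hh x y
  -- In a chain `x' ∧ x'' = 0` forces `x' = 0` or `x'' = 0`, and the latter gives `x' ≥ x''' = 1`.
  -- The identities then reduce to these two values of `x'`.
  have h01 : ∀ x : A, xᵈ = ⊥ ∨ xᵈ = ⊤ := by
    intro x
    rcases hc xᵈ xᵈᵈ with h | h
    · left
      rw [← hst x, inf_eq_left.2 h]
    · right
      have hb := hst x
      rw [inf_eq_right.2 h] at hb
      have := prime_prime_le xᵈ
      rwa [hb, prime_bot, top_le_iff] at this
  have ht : (⊤ : A) ⇨ ⊥ = ⊥ := by
    simpa using SemiHeytingAlgebra.sh1 (⊤ : A) ⊥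
  rw [mem_JIDL₁_iff]
  refine ⟨?_, ?_, ?_⟩
  · intro x y z
    rcases h01 x with h | h <;> simp [h, SemiHeytingAlgebra.sh3]
  · intro x y
    rcases hc x y with h | h <;> simp [hle _ _ h]
  · intro x
    rcases h01 x with h | h <;>
      simp [levelTerm, primeStarIter, pcompl, h, ht, SemiHeytingAlgebra.sh3, prime_top]

theorem D₂_mem_JIDL₁.{u} : (⟨D₂⟩ : DQD.{u}) ∈ JIDL₁ := by
  rw [mem_JIDL₁_iff]
  refine ⟨?_, ?_, ?_⟩
  · rintro (_ | _) (_ | _) (_ | _) <;> rfl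
  · rintro (_ | _) (_ | _) <;> rfl
  · rintro (_ | _) <;> rfl

end DQD

theorem corollary6p8 :
    DQD.JIDL₁ = DQD.varietyJoin DQD.DStHC (DQD.generatedVariety {⟨D₂⟩}) := by
  refine Set.Subset.antisymm ?_ ?_
  · refine Set.subset_sInter ?_
    rintro V ⟨hV, hKV⟩ A hA
    have := DQD.mem_JIDL₁_iff.1 hA
    have hsub : (DQD.DStH ∩ DQD.chains) ∪ {⟨D₂⟩} ⊆ V := by
      refine (Set.union_subset_union ?_ ?_).trans hKV
      · exact DQD.subset_generatedVariety _
      · exact DQD.subset_generatedVariety _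
    refine hV.mem_of_separating A fun u v huv => ?_
    by_cases h : u ≤ v
    · obtain ⟨B, hB, f, hf, hne⟩ :=
        DQD.exists_separating_hom fun h' : v ≤ u => huv (le_antisymm h h')
      exact ⟨B, hsub hB, f, hf, hne.symm⟩
    · obtain ⟨B, hB, f, hf, hne⟩ := DQD.exists_separating_hom h
      exact ⟨B, hsub hB, f, hf, hne⟩
  · refine DQD.generatedVariety_subset DQD.isVariety_JIDL₁ (Set.union_subset ?_ ?_)
    · exact DQD.generatedVariety_subset DQD.isVariety_JIDL₁ DQD.chain_subset_JIDL₁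
    · exact DQD.generatedVariety_subset DQD.isVariety_JIDL₁
        (Set.singleton_subset_iff.2 DQD.D₂_mem_JIDL₁)
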